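/- An instance $(G,<)$ of the stable marriage problem consists of a finite bipartite graph $G$ with sides $A$ (men) and $B$ (women) and edge set $E(G)\subseteq A\times B$, together with, for every $v\in A\cup B$, a strict linear order $<_v$ on the neighbors of $v$. A matching is a set of edges (not necessarily perfect) with at most one edge at every agent. An edge $ab\in E(G)$ blocks a matching $M$ if each of $a$ and $b$ is either unmatched in $M$ or strictly prefers the other to their partner in $M$. A matching is stable if no edge blocks it; $\mathcal S(G,<)$ is the set of stable matchings. A matching $M'$ blocks $M$ if some edge of $M'$ blocks $M$. A set $\mathcal L'$ of matchings has the legal property if the matchings blocked by some member of $\mathcal L'$ are exactly the matchings not in $\mathcal L'$. The set $\mathcal L(G,<)$ of legal matchings is the unique set of matchings with the legal property, and $G_L$ is the spanning subgraph of $G$ whose edges are those contained in some legal matching. The instance $(G,<)$ with $|A|=|B|=n$ is Latin if $E(G)=A\times B$ and there is an $n\times n$ Latin square $Q$ (rows indexed by $A$, columns by $B$, every row and every column a permutation of $1,\dots,n$) such that for all $a\in A$, $b\in B$ the position of $b$ in the list of $a$ is $Q(a,b)$ and the position of $a$ in the list of $b$ is $n+1-Q(a,b)$, where position $1$ is the favorite.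 **Theorem.** Let $(G,<)$ be a Latin instance with $n$ men and $n$ women. Then exactly one set of matchings of $(G,<)$ has the legal property, $G_L=G$, and $\mathcal L(G,<)=\mathcal S(G,<)$. Moreover, there is an instance $(G',<')$, obtained from $(G,<)$ by adding one man $\tilde a$ and one woman $\tilde b$ (on $A\cup B$ the graph and the preferences are those of $(G,<)$), such that exactly one set of matchings of $(G',<')$ has the legal property, $$|\mathcal S(G',<')|=1\qquad\text{and}\qquad \mathcal L(G',<')=\{M\cup\{\tilde a\tilde b\}: M\in\mathcal S(G,<)\}.$$ Furthermore, there are instances with only one stable matching but exponentially many legal matchings: for each odd $n$ there is an instance $(G_n,<_n)$ with $n$ men and $n$ women, in which exactly one set of matchings has the legal property, such that $|\mathcal S(G_n,<_n)|=1$ and $|\mathcal L(G_n,<_n)|=\omega(2^n)$ as $n\to\infty$ over odd $n$. -/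

import Mathlib

/-- An instance `(G, <)` of the stable marriage problem, with men `A` and women `B`: a bipartite
graph `G` with sides `A` and `B`, given by its set `edges` of man-woman pairs, and for every agent
a strict linear order on the neighbors of that agent in `G`.
`manLt a b b'` is `b <_a b'` (man `a` strictly prefers `b'` to `b`), and
`womanLt b a a'` is `a <_b a'` (woman `b` strictly prefers `a'` to `a`). -/
structure StableMarriage (A B : Type*) where
  edges : Set (A × B)
  manLt : A → B → B → Prop
  womanLt : B → A → A → Prop
  manLt_edges : ∀ a b b', manLt a b b' → (a, b) ∈ edges ∧ (a, b') ∈ edges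
  manLt_irrefl : ∀ a b, ¬ manLt a b b
  manLt_trans : ∀ a b b' b'', manLt a b b' → manLt a b' b'' → manLt a b b''
  manLt_total : ∀ a b b', (a, b) ∈ edges → (a, b') ∈ edges → b ≠ b' →
    manLt a b b' ∨ manLt a b' b
  womanLt_edges : ∀ b a a', womanLt b a a' → (a, b) ∈ edges ∧ (a', b) ∈ edges
  womanLt_irrefl : ∀ b a, ¬ womanLt b a a
  womanLt_trans : ∀ b a a' a'', womanLt b a a' → womanLt b a' a'' → womanLt b a a''
  womanLt_total : ∀ b a a', (a, b) ∈ edges → (a', b) ∈ edges → a ≠ a' →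
    womanLt b a a' ∨ womanLt b a' a

namespace StableMarriage

/-- The set of all matchings of `G`, perfect or not: sets of edges in which every man and
every woman lies on at most one edge. -/
def matchings {A B : Type*} (P : StableMarriage A B) : Set (Set (A × B)) :=
  {M | M ⊆ P.edges ∧
    (∀ a b b', (a, b) ∈ M → (a, b') ∈ M → b = b') ∧
    (∀ a a' b, (a, b) ∈ M → (a', b) ∈ M → a = a')}

/-- The edge `e = ab` blocks the matching `M`: `a` is unmatched in `M` or strictly prefers `b` to
his partner, and `b` is unmatched in `M` or strictly prefers `a` to her partner. -/
def EdgeBlocks {A B : Type*} (P : StableMarriage A B) (e : A × B) (M : Set (A × B)) : Prop :=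
  e ∈ P.edges ∧ (∀ b', (e.1, b') ∈ M → P.manLt e.1 b' e.2) ∧
    (∀ a', (a', e.2) ∈ M → P.womanLt e.2 a' e.1)

/-- The set `S(G, <)` of stable matchings. -/
def stableMatchings {A B : Type*} (P : StableMarriage A B) : Set (Set (A × B)) :=
  {M | M ∈ P.matchings ∧ ∀ e ∈ P.edges, ¬ P.EdgeBlocks e M}

/-- The matching `M'` blocks the matching `M`: some edge of `M'` blocks `M`. -/
def Blocks {A B : Type*} (P : StableMarriage A B) (M' M : Set (A × B)) : Prop :=
  ∃ e ∈ M', P.EdgeBlocks e M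

/-- `I(L)`: the matchings that are blocked by some matching in `L`. -/
def blockedBy {A B : Type*} (P : StableMarriage A B) (L : Set (Set (A × B))) :
    Set (Set (A × B)) :=
  {M | M ∈ P.matchings ∧ ∃ M' ∈ L, P.Blocks M' M}

/-- A set `L` of matchings has the legal property if the matchings blocked by some member of `L`
are exactly the matchings outside `L`. -/
def HasLegalProperty {A B : Type*} (P : StableMarriage A B) (L : Set (Set (A × B))) : Prop :=
  L ⊆ P.matchings ∧ P.blockedBy L = P.matchings \ L

/-- The set `L(G, <)` of legal matchings, that is, the members of the set of matchings with the
legal property. (A matching counts as legal if it belongs to a set with the legal property; when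
that set is unique, `legalMatchings` is that set.) -/
def legalMatchings {A B : Type*} (P : StableMarriage A B) : Set (Set (A × B)) :=
  {M | ∃ L, P.HasLegalProperty L ∧ M ∈ L}

/-- The edge set of the spanning subgraph `G_L` of `G`: the edges that lie in some legal
matching. -/
def legalEdges {A B : Type*} (P : StableMarriage A B) : Set (A × B) :=
  {e | ∃ M ∈ P.legalMatchings, e ∈ M}

/-- The rank of `b` in the list of `a`: its position, the favorite having rank `1`. -/
noncomputable def manRank {A B : Type*} (P : StableMarriage A B) (a : A) (b : B) : ℕ :=
  {b' | P.manLt a b b'}.ncard + 1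

/-- The rank of `a` in the list of `b`: its position, the favorite having rank `1`. -/
noncomputable def womanRank {A B : Type*} (P : StableMarriage A B) (b : B) (a : A) : ℕ :=
  {a' | P.womanLt b a a'}.ncard + 1

/-- An `n × n` Latin square with rows `A` and columns `B`: every row and every column is a
permutation of `1, …, n`. -/
def IsLatinSquare {A B : Type*} (n : ℕ) (Q : A → B → ℕ) : Prop :=
  Nat.card A = n ∧ Nat.card B = n ∧
    (∀ a, Set.BijOn (fun b => Q a b) Set.univ (Set.Icc 1 n)) ∧
    (∀ b, Set.BijOn (fun a => Q a b) Set.univ (Set.Icc 1 n))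

/-- `(G, <)` is a Latin instance with `n` men and `n` women: the lists are complete and, for some
`n × n` Latin square `Q`, the rank of `b` in the list of `a` is `Q a b` and the rank of `a` in the
list of `b` is `n + 1 - Q a b`. -/
def IsLatin {A B : Type*} (P : StableMarriage A B) (n : ℕ) : Prop :=
  P.edges = Set.univ ∧ ∃ Q : A → B → ℕ, IsLatinSquare n Q ∧
    (∀ a b, P.manRank a b = Q a b) ∧ (∀ a b, P.womanRank b a + Q a b = n + 1)

/-- `P'` is obtained from `P` by adding one man `none` and one woman `none`: on the old men and
women, the graph and the preferences are those of `P`. -/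
def IsOnePairExtension {A B : Type*} (P : StableMarriage A B)
    (P' : StableMarriage (Option A) (Option B)) : Prop :=
  (∀ a b, (some a, some b) ∈ P'.edges ↔ (a, b) ∈ P.edges) ∧
  (∀ a b b', P'.manLt (some a) (some b) (some b') ↔ P.manLt a b b') ∧
  (∀ b a a', P'.womanLt (some b) (some a) (some a') ↔ P.womanLt b a a')

/-- The matching `M ∪ {ãb̃}`, where `ã` and `b̃` are the new man and the new woman. -/
def addNewPair {A B : Type*} (M : Set (A × B)) : Set (Option A × Option B) :=
  insert (none, none) ((fun e : A × B => (some e.1, some e.2)) '' M)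

end StableMarriage

namespace StableMarriage

/-! ### Blocking, the legal property and saturated instances -/

section Basic

variable {A B : Type*} {P : StableMarriage A B}

/-! A stable matching is blocked by nothing, so it belongs to every set with the legal property. If
moreover every edge lies in a stable matching, a member of such a set can be blocked by no edge at
all, so the legal matchings are exactly the stable ones. In a Latin instance the entries equal to
`k` form a stable matching: an edge blocking it would need an entry below `k` for the man and above
`k` for the woman. Hence every edge lies in a stable matching.

For the extension, every old man ranks the new woman second, and she ranks the new man last, who
knows only her. Let `M₀` give every man his favorite. With the new pair added it is stable, hence
legal, and any matching it does not block is perfect on the old agents and contains the new pair. So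
no legal matching uses an edge from an old man to the new woman, and legality reduces to stability
in the old instance. Such edges still count for stability: they block whenever some old man misses
his favorite, so only `M₀` with the new pair is stable.

Only `IsSaturated` is used here, not the Latin property, so the construction also applies to
disjoint unions. The `8 × 8` square given by bitwise xor has at least 268 stable matchings, and `268
> 2 ^ 8`. Taking many copies, padding with single edges and adding one pair gives at least `268 ^
((n - 1) / 8)` legal matchings, which outgrows `2 ^ n`. -/

theorem manRank_lt_of_manLt [Finite B] {a : A} {b b' : B} (h : P.manLt a b b') :
    P.manRank a b' < P.manRank a b := by
  refine Nat.succ_lt_succ (Set.ncard_lt_ncard ?_ (Set.toFinite _))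
  refine ⟨fun c hc => P.manLt_trans a b b' c h hc, fun hs => P.manLt_irrefl a b' (hs h)⟩

theorem womanRank_lt_of_womanLt [Finite A] {b : B} {a a' : A} (h : P.womanLt b a a') :
    P.womanRank b a' < P.womanRank b a := by
  refine Nat.succ_lt_succ (Set.ncard_lt_ncard ?_ (Set.toFinite _))
  refine ⟨fun c hc => P.womanLt_trans b a a' c h hc, fun hs => P.womanLt_irrefl b a' (hs h)⟩

/-- The legal property as a fixed-point condition: `L` is a kernel of the blocking relation on
matchings. All later arguments use this form. -/
theorem hasLegalProperty_iff {L : Set (Set (A × B))} :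
    P.HasLegalProperty L ↔
      ∀ M, M ∈ L ↔ M ∈ P.matchings ∧ ¬ ∃ M' ∈ L, P.Blocks M' M := by
  constructor
  · rintro ⟨hL, h⟩ M
    have hM : M ∈ P.blockedBy L ↔ M ∈ P.matchings \ L := by rw [h]
    simp only [blockedBy, Set.mem_ofPred_eq, Set.mem_sdiff] at hM
    have := @hL M
    generalize (∃ M' ∈ L, P.Blocks M' M) = p at *
    tauto
  · intro h
    refine ⟨fun M hM => ((h M).1 hM).1, ?_⟩
    ext M
    simp only [blockedBy, Set.mem_ofPred_eq, Set.mem_sdiff]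
    have := h M
    generalize (∃ M' ∈ L, P.Blocks M' M) = p at *
    tauto

theorem legalMatchings_eq {L₀ : Set (Set (A × B))}
    (h : ∀ L, P.HasLegalProperty L ↔ L = L₀) : P.legalMatchings = L₀ := by
  ext M
  simp [legalMatchings, h]

theorem existsUnique_of_hasLegalProperty_iff {L₀ : Set (Set (A × B))}
    (h : ∀ L, P.HasLegalProperty L ↔ L = L₀) : ∃! L, P.HasLegalProperty L :=
  ⟨L₀, (h _).2 rfl, fun L hL => (h L).1 hL⟩

theorem not_blocks_of_mem_stableMatchings {M M' : Set (A × B)} (hM : M ∈ P.stableMatchings) :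
    ¬ P.Blocks M' M :=
  fun ⟨e, _, he⟩ => hM.2 e he.1 he

/-- If every edge lies in a stable matching, then the legal matchings are the stable ones. -/
theorem hasLegalProperty_iff_eq_stableMatchings
    (hE : ∀ e ∈ P.edges, ∃ M ∈ P.stableMatchings, e ∈ M) (L : Set (Set (A × B))) :
    P.HasLegalProperty L ↔ L = P.stableMatchings := by
  constructor
  · intro h
    rw [hasLegalProperty_iff] at h
    have hS : P.stableMatchings ⊆ L := fun M hM =>
      (h M).2 ⟨hM.1, fun ⟨_, _, hb⟩ => not_blocks_of_mem_stableMatchings hM hb⟩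
    refine Set.Subset.antisymm (fun M hM => ⟨((h M).1 hM).1, fun e he hb => ?_⟩) hS
    obtain ⟨M', hM', heM'⟩ := hE e he
    exact ((h M).1 hM).2 ⟨M', hS hM', e, heM', hb⟩
  · rintro rfl
    refine hasLegalProperty_iff.2 fun M => ⟨fun hM => ⟨hM.1, fun ⟨_, _, hb⟩ =>
      not_blocks_of_mem_stableMatchings hM hb⟩, fun ⟨hM, hb⟩ => ⟨hM, fun e he heb => ?_⟩⟩
    obtain ⟨M', hM', heM'⟩ := hE e he
    exact hb ⟨M', hM', e, heM', heb⟩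

/-- Every edge lies in a stable matching, and there is a perfect matching `M₀` that gives every
man his favorite woman. -/
structure IsSaturated (P : StableMarriage A B) (M₀ : Set (A × B)) : Prop where
  edge_mem : ∀ e ∈ P.edges, ∃ M ∈ P.stableMatchings, e ∈ M
  mem : M₀ ∈ P.matchings
  woman : ∀ b, ∃ a, (a, b) ∈ M₀
  man : ∀ a, ∃ b, (a, b) ∈ M₀
  favorite : ∀ a b b', (a, b) ∈ M₀ → ¬ P.manLt a b b'

theorem IsSaturated.manLt_of_mem {M₀ : Set (A × B)} (h : P.IsSaturated M₀) {a : A} {b b' : B}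
    (hb : (a, b) ∈ M₀) (hb' : (a, b') ∈ P.edges) (hne : b' ≠ b) : P.manLt a b' b :=
  (P.manLt_total a b' b hb' (h.mem.1 hb) hne).resolve_right (h.favorite a b b' hb)

theorem IsSaturated.mem_stableMatchings {M₀ : Set (A × B)} (h : P.IsSaturated M₀) :
    M₀ ∈ P.stableMatchings := by
  refine ⟨h.mem, fun e _ hb => ?_⟩
  obtain ⟨b, hab⟩ := h.man e.1
  exact h.favorite _ _ _ hab (hb.2.1 b hab)

/-- In a saturated instance, a matching that covers all women covers all men. -/
theorem IsSaturated.covers_men [Finite B] {M₀ : Set (A × B)} (h : P.IsSaturated M₀)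
    {M : Set (A × B)} (hm : ∀ a b b', (a, b) ∈ M → (a, b') ∈ M → b = b')
    (hc : ∀ b, ∃ a, (a, b) ∈ M) (a : A) : ∃ b, (a, b) ∈ M := by
  choose f hf using hc
  choose g hg using h.man
  -- Sending a woman to the `M₀`-wife of her `M`-husband is an injective self-map of the finite set
  -- `B`, hence surjective. This replaces a comparison of cardinalities.
  have hinj : Function.Injective (g ∘ f) := by
    intro b b' hbb
    have h1 := hg (f b)
    have h2 := hg (f b')
    rw [show g (f b) = g (f b') from hbb] at h1
    have h3 := h.mem.2.2 _ _ _ h1 h2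
    have h4 := hf b'
    rw [← h3] at h4
    exact hm _ _ _ (hf b) h4
  obtain ⟨b, hb⟩ := (Finite.injective_iff_surjective.1 hinj) (g a)
  have h1 := hg (f b)
  rw [show g (f b) = g a from hb] at h1
  exact ⟨b, h.mem.2.2 _ _ _ h1 (hg a) ▸ hf b⟩

end Basic

/-! ### Adding one pair -/

section Extension

variable {A B : Type*}

/-- The instance obtained from `P` by adding a man `none`, adjacent to the woman `none` only, and
a woman `none`, whom every old man ranks right below his favorite, and whose least favorite is the
man `none`. -/
def extend (P : StableMarriage A B) : StableMarriage (Option A) (Option B) where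
  edges := {e | match e with
    | (some a, some b) => (a, b) ∈ P.edges
    | (none, some _) => False
    | (_, none) => True}
  manLt a b b' := match a, b, b' with
    | some a, some b, some b' => P.manLt a b b'
    | some a, none, some b' => (a, b') ∈ P.edges ∧ ∀ c, ¬ P.manLt a b' c
    | some a, some b, none => ∃ c, P.manLt a b c
    | _, _, _ => False
  womanLt b a a' := match b, a, a' with
    | some b, some a, some a' => P.womanLt b a a'
    | none, none, some _ => True
    -- How the new woman orders the old men is irrelevant; any strict linear order serves.
    | none, some a, some a' => WellOrderingRel a a'
    | _, _, _ => False
  manLt_edges := by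
    rintro (_ | a) (_ | b) (_ | b') h <;> simp at h ⊢
    · exact h.1
    · obtain ⟨c, hc⟩ := h
      exact (P.manLt_edges _ _ _ hc).1
    · exact P.manLt_edges _ _ _ h
  manLt_irrefl := by
    rintro (_ | a) (_ | b) h <;> simp at h
    exact P.manLt_irrefl _ _ h
  manLt_trans := by
    rintro (_ | a) (_ | b) (_ | b') (_ | b'') h h' <;> simp at h h' ⊢
    · obtain ⟨c, hc⟩ := h'
      exact h.2 c hc
    · exact absurd h' (h.2 _)
    · obtain ⟨c, hc⟩ := h
      have hbc := (P.manLt_edges _ _ _ hc).1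
      have hne : b ≠ b'' := by
        rintro rfl
        exact h'.2 _ hc
      exact (P.manLt_total a b b'' hbc h'.1 hne).resolve_right (h'.2 _)
    · exact ⟨_, h⟩
    · exact P.manLt_trans _ _ _ _ h h'
  manLt_total := by
    rintro (_ | a) (_ | b) (_ | b') h h' hne <;> simp at h h' hne ⊢
    · rw [or_comm, ← not_exists]
      by_cases hc : ∃ c, P.manLt a b' c <;> tauto
    · rw [← not_exists]
      by_cases hc : ∃ c, P.manLt a b c <;> tauto
    · exact P.manLt_total _ _ _ h h' hne
  womanLt_edges := by
    rintro (_ | b) (_ | a) (_ | a') h <;> simp at h ⊢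
    exact P.womanLt_edges _ _ _ h
  womanLt_irrefl := by
    rintro (_ | b) (_ | a) h <;> simp at h
    · exact irrefl _ h
    · exact P.womanLt_irrefl _ _ h
  womanLt_trans := by
    rintro (_ | b) (_ | a) (_ | a') (_ | a'') h h' <;> simp at h h' ⊢
    · exact _root_.trans h h'
    · exact P.womanLt_trans _ _ _ _ h h'
  womanLt_total := by
    rintro (_ | b) (_ | a) (_ | a') h h' hne <;> simp at h h' hne ⊢
    · exact (trichotomous_of WellOrderingRel a a').imp_right fun hh => hh.resolve_left hne
    · exact P.womanLt_total _ _ _ h h' hne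

theorem isOnePairExtension_extend (P : StableMarriage A B) : P.IsOnePairExtension P.extend :=
  ⟨fun _ _ => Iff.rfl, fun _ _ _ => Iff.rfl, fun _ _ _ => Iff.rfl⟩

variable {P : StableMarriage A B} {M : Set (A × B)}

@[simp] theorem some_some_mem_addNewPair {a : A} {b : B} :
    (some a, some b) ∈ addNewPair M ↔ (a, b) ∈ M := by
  simp [addNewPair]

@[simp] theorem none_none_mem_addNewPair : (none, none) ∈ addNewPair M := by
  simp [addNewPair]

@[simp] theorem some_none_mem_addNewPair {a : A} : (some a, none) ∉ addNewPair M := by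
  simp [addNewPair]

@[simp] theorem none_some_mem_addNewPair {b : B} : (none, some b) ∉ addNewPair M := by
  simp [addNewPair]

theorem addNewPair_injective : Function.Injective (addNewPair : Set (A × B) → _) := by
  intro M N h
  ext ⟨a, b⟩
  rw [← some_some_mem_addNewPair, h, some_some_mem_addNewPair]

theorem addNewPair_mem_matchings (hM : M ∈ P.matchings) : addNewPair M ∈ P.extend.matchings := by
  refine ⟨?_, ?_, ?_⟩
  · rintro ⟨_ | a, _ | b⟩ h <;> simp at h ⊢
    · trivial
    · exact hM.1 h
  · rintro (_ | a) (_ | b) (_ | b') h h' <;> simp at h h' ⊢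
    exact hM.2.1 _ _ _ h h'
  · rintro (_ | a) (_ | a') (_ | b) h h' <;> simp at h h' ⊢
    exact hM.2.2 _ _ _ h h'

theorem edgeBlocks_extend_addNewPair {a : A} {b : B} :
    P.extend.EdgeBlocks (some a, some b) (addNewPair M) ↔ P.EdgeBlocks (a, b) M := by
  simp [EdgeBlocks, extend, Option.forall]

theorem not_edgeBlocks_extend_addNewPair {b : Option B} :
    ¬ P.extend.EdgeBlocks (none, b) (addNewPair M) := by
  intro h
  exact h.2.1 none none_none_mem_addNewPair

theorem none_some_notMem_edges_extend {b : B} : (none, some b) ∉ P.extend.edges :=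
  fun h => h

/-- A matching that is not blocked by the man-optimal matching contains the new pair and is
perfect. -/
theorem IsSaturated.exists_eq_addNewPair [Finite B] {M₀ : Set (A × B)} (h : P.IsSaturated M₀)
    {N : Set (Option A × Option B)} (hN : N ∈ P.extend.matchings)
    (hb : ¬ P.extend.Blocks (addNewPair M₀) N) :
    ∃ M ∈ P.matchings, (∀ a, ∃ b, (a, b) ∈ M) ∧ N = addNewPair M := by
  set M : Set (A × B) := {e | (some e.1, some e.2) ∈ N} with hMdef
  have hMm : M ∈ P.matchings := by
    refine ⟨fun e he => hN.1 he, fun a b b' h1 h2 => ?_, fun a a' b h1 h2 => ?_⟩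
    · exact Option.some_injective _ (hN.2.1 _ _ _ h1 h2)
    · exact Option.some_injective _ (hN.2.2 _ _ _ h1 h2)
  have hcov : ∀ b, ∃ a, (a, b) ∈ M := by
    intro b
    by_contra hcon
    push Not at hcon
    obtain ⟨a, hab⟩ := h.woman b
    -- An unmatched old woman blocks together with the man whose favorite she is.
    refine hb ⟨(some a, some b), by simpa using hab, h.mem.1 hab, ?_, ?_⟩
    · rintro (_ | b') hb'
      · exact ⟨h.mem.1 hab, fun c => h.favorite a b c hab⟩
      · refine h.manLt_of_mem hab (hN.1 hb') ?_
        rintro rfl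
        exact hcon _ hb'
    · rintro (_ | a') ha'
      · exact absurd (hN.1 ha') none_some_notMem_edges_extend
      · exact absurd ha' (hcon a')
  have hmen := h.covers_men hMm.2.1 hcov
  have hnone : ∀ a, (some a, none) ∉ N := by
    intro a ha
    obtain ⟨b, hab⟩ := hmen a
    simpa using hN.2.1 _ _ _ ha hab
  refine ⟨M, hMm, hmen, ?_⟩
  ext ⟨_ | a, _ | b⟩
  · simp only [none_none_mem_addNewPair, iff_true]
    by_contra hcon
    -- All old men have old wives, so without the new pair both new agents would be single and would
    -- block.
    refine hb ⟨(none, none), by simp, trivial, ?_, ?_⟩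
    · rintro (_ | b') hb'
      · exact absurd hb' hcon
      · exact absurd (hN.1 hb') none_some_notMem_edges_extend
    · rintro (_ | a') ha'
      · exact absurd ha' hcon
      · exact absurd ha' (hnone a')
  · simpa using fun hh => none_some_notMem_edges_extend (hN.1 hh)
  · simpa using hnone a
  · simp [hMdef]

theorem IsSaturated.addNewPair_mem_stableMatchings {M₀ : Set (A × B)} (h : P.IsSaturated M₀) :
    addNewPair M₀ ∈ P.extend.stableMatchings := by
  refine ⟨addNewPair_mem_matchings h.mem, ?_⟩
  rintro ⟨_ | a, b⟩ he hb
  · exact not_edgeBlocks_extend_addNewPair hb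
  · obtain ⟨b₀, hab⟩ := h.man a
    have := hb.2.1 (some b₀) (by simpa using hab)
    cases b with
    | none =>
      obtain ⟨c, hc⟩ := this
      exact h.favorite _ _ _ hab hc
    | some b => exact h.favorite _ _ _ hab this

theorem IsSaturated.stableMatchings_extend [Finite B] {M₀ : Set (A × B)} (h : P.IsSaturated M₀) :
    P.extend.stableMatchings = {addNewPair M₀} := by
  refine Set.Subset.antisymm (fun N hN => ?_)
    (Set.singleton_subset_iff.2 h.addNewPair_mem_stableMatchings)
  obtain ⟨M, hM, hmen, rfl⟩ :=
    h.exists_eq_addNewPair hN.1 (not_blocks_of_mem_stableMatchings hN)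
  have key : ∀ a b b', (a, b) ∈ M → (a, b') ∈ M₀ → b = b' := by
    intro a b b' hab hab'
    by_contra hne
    -- A man without his favorite prefers the new woman to his wife, and she prefers him to the new
    -- man.
    refine hN.2 (some a, none) trivial ⟨trivial, ?_, ?_⟩
    · rintro (_ | c) hc
      · simp at hc
      · obtain rfl := hM.2.1 _ _ _ hab (by simpa using hc)
        exact ⟨b', h.manLt_of_mem hab' (hM.1 hab) hne⟩
    · rintro (_ | a') ha'
      · trivial
      · simp at ha'
  rw [Set.mem_singleton_iff]
  congr 1
  ext ⟨a, b⟩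
  constructor
  · intro hab
    obtain ⟨b', hb'⟩ := h.man a
    exact key a b b' hab hb' ▸ hb'
  · intro hab
    obtain ⟨b', hb'⟩ := hmen a
    exact key a b' b hb' hab ▸ hb'

/-- The new pair lies in both matchings, and an old edge blocks after the extension only if it
blocked before. -/
theorem not_blocks_addNewPair {M N : Set (A × B)} (hM : M ∈ P.stableMatchings) :
    ¬ P.extend.Blocks (addNewPair N) (addNewPair M) := by
  rintro ⟨⟨_ | a, _ | b⟩, he, hb⟩
  · exact not_edgeBlocks_extend_addNewPair hb
  · exact not_edgeBlocks_extend_addNewPair hb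
  · simp at he
  · rw [edgeBlocks_extend_addNewPair] at hb
    exact hM.2 _ hb.1 hb

/-- The extended `M₀` lies in either candidate set and forces every member to have the form
`addNewPair M`. Blocking between such matchings uses old edges only, and every old edge is available
through a stable matching. -/
theorem IsSaturated.hasLegalProperty_extend_iff [Finite B] {M₀ : Set (A × B)}
    (h : P.IsSaturated M₀) (L : Set (Set (Option A × Option B))) :
    P.extend.HasLegalProperty L ↔ L = addNewPair '' P.stableMatchings := by
  constructor
  · intro hL
    rw [hasLegalProperty_iff] at hL
    have h0 : addNewPair M₀ ∈ L := (hL _).2 ⟨h.addNewPair_mem_stableMatchings.1,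
      fun ⟨_, _, hb⟩ => not_blocks_of_mem_stableMatchings h.addNewPair_mem_stableMatchings hb⟩
    have hform : ∀ N ∈ L, ∃ M ∈ P.matchings, N = addNewPair M := fun N hN => by
      obtain ⟨M, hM, -, hNM⟩ := h.exists_eq_addNewPair ((hL N).1 hN).1
        fun hb => ((hL N).1 hN).2 ⟨_, h0, hb⟩
      exact ⟨M, hM, hNM⟩
    have hsub : ∀ M ∈ P.stableMatchings, addNewPair M ∈ L := fun M hM => by
      refine (hL _).2 ⟨addNewPair_mem_matchings hM.1, ?_⟩
      rintro ⟨N, hN, hb⟩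
      obtain ⟨M', -, rfl⟩ := hform N hN
      exact not_blocks_addNewPair hM hb
    refine Set.Subset.antisymm (fun N hN => ?_) (Set.image_subset_iff.2 hsub)
    obtain ⟨M, hM, rfl⟩ := hform N hN
    refine ⟨M, ⟨hM, fun e he hb => ?_⟩, rfl⟩
    obtain ⟨M', hM', heM'⟩ := h.edge_mem e he
    exact ((hL _).1 hN).2 ⟨_, hsub M' hM', (some e.1, some e.2), by simpa using heM',
      edgeBlocks_extend_addNewPair.2 hb⟩
  · rintro rfl
    refine hasLegalProperty_iff.2 fun N => ⟨?_, ?_⟩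
    · rintro ⟨M, hM, rfl⟩
      refine ⟨addNewPair_mem_matchings hM.1, ?_⟩
      rintro ⟨_, ⟨M', -, rfl⟩, hb⟩
      exact not_blocks_addNewPair hM hb
    · rintro ⟨hN, hb⟩
      obtain ⟨M, hM, -, rfl⟩ := h.exists_eq_addNewPair hN
        fun hb' => hb ⟨_, ⟨M₀, h.mem_stableMatchings, rfl⟩, hb'⟩
      refine ⟨M, ⟨hM, fun e he heb => ?_⟩, rfl⟩
      obtain ⟨M', hM', heM'⟩ := h.edge_mem e he
      exact hb ⟨_, ⟨M', hM', rfl⟩, (some e.1, some e.2), by simpa using heM',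
        edgeBlocks_extend_addNewPair.2 heb⟩

end Extension

/-! ### Latin instances are saturated -/

section Latin

variable {A B : Type*} [Finite A] [Finite B] {n : ℕ} {P : StableMarriage A B}

/-- The entries `k` of the Latin square of a Latin instance form a stable matching. -/
theorem latin_class_mem_stableMatchings {Q : A → B → ℕ} (hE : P.edges = Set.univ)
    (hQ : IsLatinSquare n Q) (hm : ∀ a b, P.manRank a b = Q a b)
    (hw : ∀ a b, P.womanRank b a + Q a b = n + 1) {k : ℕ} (hk : k ∈ Set.Icc 1 n) :
    {e : A × B | Q e.1 e.2 = k} ∈ P.stableMatchings := by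
  refine ⟨⟨by simp [hE], fun a b b' h h' => ?_, fun a a' b h h' => ?_⟩, ?_⟩
  · exact (hQ.2.2.1 a).injOn trivial trivial (h.trans h'.symm)
  · exact (hQ.2.2.2 b).injOn trivial trivial (h.trans h'.symm)
  · rintro ⟨a, b⟩ - ⟨-, h1, h2⟩
    obtain ⟨b', -, hb'⟩ := (hQ.2.2.1 a).surjOn hk
    obtain ⟨a', -, ha'⟩ := (hQ.2.2.2 b).surjOn hk
    -- The man's preference gives `Q a b < k`; the woman's, with reversed ranks, gives `k < Q a b`.
    have h3 := manRank_lt_of_manLt (h1 b' hb')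
    have h4 := womanRank_lt_of_womanLt (h2 a' ha')
    have h5 := hw a b
    have h6 := hw a' b
    simp only [hm] at h3 hb' ha'
    simp only at h4
    omega

theorem IsLatin.exists_isSaturated (h : P.IsLatin n) : ∃ M₀, P.IsSaturated M₀ := by
  obtain ⟨hE, Q, hQ, hm, hw⟩ := h
  -- The value `1` occurs only if `n` is positive, so an agent is needed.
  have hone : (Nonempty A ∨ Nonempty B) → 1 ∈ Set.Icc 1 n := by
    rintro (hA | hB)
    · exact ⟨le_rfl, hQ.1 ▸ Nat.card_pos⟩
    · exact ⟨le_rfl, hQ.2.1 ▸ Nat.card_pos⟩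
  refine ⟨{e | Q e.1 e.2 = 1}, ⟨?_, ?_, ?_, ?_, ?_⟩⟩
  · rintro ⟨a, b⟩ -
    exact ⟨_, latin_class_mem_stableMatchings hE hQ hm hw ((hQ.2.2.1 a).mapsTo (Set.mem_univ b)),
      rfl⟩
  · refine ⟨by simp [hE], fun a b b' h h' => ?_, fun a a' b h h' => ?_⟩
    · exact (hQ.2.2.1 a).injOn trivial trivial (h.trans h'.symm)
    · exact (hQ.2.2.2 b).injOn trivial trivial (h.trans h'.symm)
  · intro b
    obtain ⟨a, -, ha⟩ := (hQ.2.2.2 b).surjOn (hone (.inr ⟨b⟩))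
    exact ⟨a, ha⟩
  · intro a
    obtain ⟨b, -, hb⟩ := (hQ.2.2.1 a).surjOn (hone (.inl ⟨a⟩))
    exact ⟨b, hb⟩
  · intro a b b' hb hlt
    have h1 := manRank_lt_of_manLt hlt
    have h2 := (hQ.2.2.1 a).mapsTo (Set.mem_univ b')
    simp only [hm, Set.mem_ofPred_eq, Set.mem_Icc] at h1 h2 hb
    omega

end Latin

/-! ### Invariance under renaming agents -/

section Relabel

variable {A B A' B' : Type*}

/-- The instance with the agents of `P` renamed. -/
def relabel (P : StableMarriage A B) (e : A' ≃ A) (f : B' ≃ B) : StableMarriage A' B' where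
  edges := Prod.map e f ⁻¹' P.edges
  manLt a b b' := P.manLt (e a) (f b) (f b')
  womanLt b a a' := P.womanLt (f b) (e a) (e a')
  manLt_edges _ _ _ h := P.manLt_edges _ _ _ h
  manLt_irrefl _ _ h := P.manLt_irrefl _ _ h
  manLt_trans _ _ _ _ h h' := P.manLt_trans _ _ _ _ h h'
  manLt_total _ _ _ h h' hne := P.manLt_total _ _ _ h h' (f.injective.ne hne)
  womanLt_edges _ _ _ h := P.womanLt_edges _ _ _ h
  womanLt_irrefl _ _ h := P.womanLt_irrefl _ _ h
  womanLt_trans _ _ _ _ h h' := P.womanLt_trans _ _ _ _ h h'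
  womanLt_total _ _ _ h h' hne := P.womanLt_total _ _ _ h h' (e.injective.ne hne)

variable {P : StableMarriage A B} (e : A' ≃ A) (f : B' ≃ B)

theorem preimage_mem_matchings_relabel {M : Set (A × B)} :
    Prod.map e f ⁻¹' M ∈ (P.relabel e f).matchings ↔ M ∈ P.matchings := by
  refine and_congr ?_ (and_congr ?_ ?_)
  · exact Set.preimage_subset_preimage_iff
      (by rw [(e.surjective.prodMap f.surjective).range_eq]; exact Set.subset_univ _)
  · simp [e.surjective.forall, f.surjective.forall]
  · simp [e.surjective.forall, f.surjective.forall]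

theorem edgeBlocks_relabel {M : Set (A × B)} {x : A' × B'} :
    (P.relabel e f).EdgeBlocks x (Prod.map e f ⁻¹' M) ↔ P.EdgeBlocks (Prod.map e f x) M := by
  simp [EdgeBlocks, relabel, e.surjective.forall, f.surjective.forall]

theorem blocks_relabel {M N : Set (A × B)} :
    (P.relabel e f).Blocks (Prod.map e f ⁻¹' N) (Prod.map e f ⁻¹' M) ↔ P.Blocks N M := by
  simp only [Blocks, edgeBlocks_relabel, (e.surjective.prodMap f.surjective).exists,
    Set.mem_preimage]

theorem preimage_mem_stableMatchings_relabel {M : Set (A × B)} :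
    Prod.map e f ⁻¹' M ∈ (P.relabel e f).stableMatchings ↔ M ∈ P.stableMatchings := by
  refine and_congr (preimage_mem_matchings_relabel e f) ?_
  simp only [edgeBlocks_relabel, (e.surjective.prodMap f.surjective).forall]
  rfl

theorem preimage_prodMap_bijective :
    Function.Bijective (fun M : Set (A × B) => Prod.map e f ⁻¹' M) :=
  ⟨(e.surjective.prodMap f.surjective).preimage_injective,
    (e.injective.prodMap f.injective).preimage_surjective⟩

theorem stableMatchings_relabel :
    (P.relabel e f).stableMatchings = (Prod.map e f ⁻¹' ·) '' P.stableMatchings := by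
  ext N
  obtain ⟨M, rfl⟩ := (preimage_prodMap_bijective e f).2 N
  rw [(preimage_prodMap_bijective e f).1.mem_set_image]
  exact preimage_mem_stableMatchings_relabel e f

theorem hasLegalProperty_relabel_iff {L : Set (Set (A' × B'))} :
    (P.relabel e f).HasLegalProperty L ↔
      P.HasLegalProperty ((Prod.map e f ⁻¹' ·) ⁻¹' L) := by
  simp only [hasLegalProperty_iff, (preimage_prodMap_bijective e f).2.forall,
    (preimage_prodMap_bijective e f).2.exists, preimage_mem_matchings_relabel, blocks_relabel,
    Set.mem_preimage]

theorem hasLegalProperty_relabel_iff_eq {L₀ : Set (Set (A × B))}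
    (h : ∀ L, P.HasLegalProperty L ↔ L = L₀) (L : Set (Set (A' × B'))) :
    (P.relabel e f).HasLegalProperty L ↔ L = (Prod.map e f ⁻¹' ·) '' L₀ := by
  rw [hasLegalProperty_relabel_iff, h]
  constructor
  · rintro rfl
    exact (Set.image_preimage_eq _ (preimage_prodMap_bijective e f).2).symm
  · rintro rfl
    exact Set.preimage_image_eq _ (preimage_prodMap_bijective e f).1

end Relabel

/-! ### Stable matchings of the xor square of order 8 -/

section XorSquare

/-- In the Latin instance on `{0, …, 7}` with square `x ^^^ y + 1`, the husbands `x` of `y` and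
`x'` of `y'` have distinct wives, and neither `x y'` nor `x' y` is a blocking edge. -/
def xorCompatible (x y x' y' : ℕ) : Bool :=
  !Nat.beq y y' && !(Nat.blt (Nat.xor x y') (Nat.xor x y) && Nat.blt (Nat.xor x' y') (Nat.xor x y'))
    && !(Nat.blt (Nat.xor x' y) (Nat.xor x' y') && Nat.blt (Nat.xor x y) (Nat.xor x' y))

/-- Husband `j` of `y` is compatible with the husbands `0, …, j - 1`, whose wives are listed in
`l`, the last one first. -/
def xorExtends (y j : ℕ) : List ℕ → Bool
  | [] => true
  | z :: l => xorCompatible l.length z j y && xorExtends y j l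

/-- The assignments of wives in `{0, …, 7}` to the men `0, …, j - 1` without blocking edges. -/
def xorPartialStable : ℕ → List (List ℕ)
  | 0 => [[]]
  | j + 1 => (xorPartialStable j).flatMap fun l =>
      ((List.range 8).filter fun y => xorExtends y j l).map fun y => y :: l

theorem length_xorPartialStable : (xorPartialStable 8).length = 268 := by
  -- Evaluates the backtracking search. For the lower bound it suffices that the listed assignments
  -- are distinct and stable; completeness of the list is not needed.
  decide +kernel

/-- The wife of `x` in an assignment listed from the last man to the first one. -/
def wife (l : List ℕ) (x : ℕ) : ℕ := l.getD (l.length - 1 - x) 0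

theorem wife_cons_of_lt (y : ℕ) {l : List ℕ} {x : ℕ} (hx : x < l.length) :
    wife (y :: l) x = wife l x := by
  have h : (y :: l).length - 1 - x = (l.length - 1 - x) + 1 := by
    simp only [List.length_cons]
    omega
  simp only [wife]
  rw [h, List.getD_cons_succ]

theorem wife_cons_length (y : ℕ) (l : List ℕ) : wife (y :: l) l.length = y := by
  simp [wife]

theorem xorCompatible_iff {x y x' y' : ℕ} : xorCompatible x y x' y' = true ↔
    y ≠ y' ∧ ¬ (x ^^^ y' < x ^^^ y ∧ x' ^^^ y' < x ^^^ y') ∧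
      ¬ (x' ^^^ y < x' ^^^ y' ∧ x ^^^ y < x' ^^^ y) := by
  have hb (m n : ℕ) : Nat.blt m n = true ↔ m < n := Iff.of_eq Nat.ble_eq
  have hx (m n : ℕ) : Nat.xor m n = m ^^^ n := rfl
  simp only [xorCompatible, Bool.and_eq_true, Bool.not_eq_true', ← Bool.not_eq_true, hb,
    Nat.beq_eq, hx, ne_eq, and_assoc]

theorem xorExtends_iff {y j : ℕ} {l : List ℕ} : xorExtends y j l = true ↔
    ∀ x < l.length, xorCompatible x (wife l x) j y = true := by
  induction l with
  | nil => simp [xorExtends]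
  | cons z l ih =>
    rw [xorExtends, Bool.and_eq_true, ih, List.length_cons, Nat.forall_lt_succ_right,
      wife_cons_length, and_comm]
    refine and_congr_left' (forall₂_congr fun x hx => ?_)
    rw [wife_cons_of_lt z hx]

theorem xorPartialStable_spec {j : ℕ} {l : List ℕ} (h : l ∈ xorPartialStable j) :
    l.length = j ∧ (∀ x < j, wife l x < 8) ∧
      ∀ x' < j, ∀ x < x', xorCompatible x (wife l x) x' (wife l x') = true := by
  induction j generalizing l with
  | zero => simp_all [xorPartialStable]
  | succ j ih =>
    simp only [xorPartialStable, List.mem_flatMap, List.mem_map, List.mem_filter,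
      List.mem_range] at h
    obtain ⟨l, hl, y, ⟨hy, hyl⟩, rfl⟩ := h
    obtain ⟨rfl, h8, hc⟩ := ih hl
    refine ⟨rfl, ?_, ?_⟩
    · rw [Nat.forall_lt_succ_right, wife_cons_length]
      exact ⟨fun x hx => by rw [wife_cons_of_lt y hx]; exact h8 x hx, hy⟩
    · rw [Nat.forall_lt_succ_right, wife_cons_length]
      refine ⟨fun x' hx' x hx => ?_, fun x hx => ?_⟩
      · rw [wife_cons_of_lt y hx', wife_cons_of_lt y (hx.trans hx')]
        exact hc x' hx' x hx
      · rw [wife_cons_of_lt y hx]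
        exact xorExtends_iff.1 hyl x hx

theorem nodup_xorPartialStable (j : ℕ) : (xorPartialStable j).Nodup := by
  induction j with
  | zero => simp [xorPartialStable]
  | succ j ih =>
    rw [xorPartialStable, List.nodup_flatMap]
    refine ⟨fun l _ => (List.nodup_range.filter _).map fun y y' h => (List.cons.inj h).1, ?_⟩
    refine ih.imp fun {l l'} hne => ?_
    simp only [Function.onFun, List.disjoint_left, List.mem_map]
    rintro _ ⟨y, -, rfl⟩ ⟨y', -, h⟩
    exact hne (List.cons.inj h).2.symm

/-- The assignment `w` of wives to the men `0, …, 7` is a stable perfect matching of the Latin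
instance with square `x ^^^ y + 1`. -/
structure IsXorStable (w : ℕ → ℕ) : Prop where
  lt : ∀ x < 8, w x < 8
  inj : ∀ x < 8, ∀ x' < 8, w x = w x' → x = x'
  stable : ∀ x < 8, ∀ x' < 8, ¬ (x ^^^ w x' < x ^^^ w x ∧ x' ^^^ w x' < x ^^^ w x')

theorem IsXorStable.exists_eq {w : ℕ → ℕ} (hw : IsXorStable w) {y : ℕ} (hy : y < 8) :
    ∃ x < 8, w x = y := by
  let g : Fin 8 → Fin 8 := fun x => ⟨w x, hw.lt x x.2⟩
  have hg : Function.Injective g := fun x x' h =>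
    Fin.ext (hw.inj x x.2 x' x'.2 (Fin.mk.inj_iff.1 h))
  obtain ⟨x, hx⟩ := Finite.injective_iff_surjective.1 hg ⟨y, hy⟩
  exact ⟨x, x.2, Fin.mk.inj_iff.1 hx⟩

theorem isXorStable_wife {l : List ℕ} (h : l ∈ xorPartialStable 8) : IsXorStable (wife l) := by
  obtain ⟨-, h8, hc⟩ := xorPartialStable_spec h
  simp only [xorCompatible_iff] at hc
  refine ⟨h8, fun x hx x' hx' heq => ?_, fun x hx x' hx' => ?_⟩
  · rcases lt_trichotomy x x' with hlt | rfl | hlt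
    · exact absurd heq (hc x' hx' x hlt).1
    · rfl
    · exact absurd heq.symm (hc x hx x' hlt).1
  · rcases lt_trichotomy x x' with hlt | rfl | hlt
    · exact (hc x' hx' x hlt).2.1
    · simp
    · exact (hc x hx x' hlt).2.2

/-- All edges of this matching carry the label `c`, so a blocking edge would have a label both below
and above `c`. -/
theorem isXorStable_xor {c : ℕ} (hc : c < 8) : IsXorStable (· ^^^ c) := by
  refine ⟨fun x hx => Nat.xor_lt_two_pow (n := 3) hx hc,
    fun x _ x' _ h => Nat.xor_left_injective h, fun x _ x' _ h => ?_⟩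
  simp only [← Nat.xor_assoc, Nat.xor_self, Nat.zero_xor] at h
  exact absurd (h.1.trans h.2) (lt_irrefl _)

end XorSquare

/-! ### Disjoint unions of xor squares -/

section Label

variable {A B : Type*}

/-- The instance in which the men prefer edges with small labels and the women prefer edges with
large labels. -/
def ofLabel (E : Set (A × B)) (f : A → B → ℕ)
    (hA : ∀ a b b', (a, b) ∈ E → (a, b') ∈ E → f a b = f a b' → b = b')
    (hB : ∀ a a' b, (a, b) ∈ E → (a', b) ∈ E → f a b = f a' b → a = a') :
    StableMarriage A B where
  edges := E
  manLt a b b' := (a, b) ∈ E ∧ (a, b') ∈ E ∧ f a b' < f a b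
  womanLt b a a' := (a, b) ∈ E ∧ (a', b) ∈ E ∧ f a b < f a' b
  manLt_edges _ _ _ h := ⟨h.1, h.2.1⟩
  manLt_irrefl _ _ h := lt_irrefl _ h.2.2
  manLt_trans _ _ _ _ h h' := ⟨h.1, h'.2.1, h'.2.2.trans h.2.2⟩
  manLt_total a b b' h h' hne := by
    rcases lt_trichotomy (f a b) (f a b') with hlt | heq | hlt
    · exact .inr ⟨h', h, hlt⟩
    · exact absurd (hA a b b' h h' heq) hne
    · exact .inl ⟨h, h', hlt⟩
  womanLt_edges _ _ _ h := ⟨h.1, h.2.1⟩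
  womanLt_irrefl _ _ h := lt_irrefl _ h.2.2
  womanLt_trans _ _ _ _ h h' := ⟨h.1, h'.2.1, h.2.2.trans h'.2.2⟩
  womanLt_total b a a' h h' hne := by
    rcases lt_trichotomy (f a b) (f a' b) with hlt | heq | hlt
    · exact .inl ⟨h, h', hlt⟩
    · exact absurd (hB a a' b h h' heq) hne
    · exact .inr ⟨h', h, hlt⟩

/-- The edges of the disjoint union of `N / 8` complete bipartite graphs with `8` men and `8` women
and of `N % 8` single edges. -/
def blockEdges (N : ℕ) : Set (Fin N × Fin N) :=
  {e | (e.1 : ℕ) / 8 = e.2 / 8 ∧ ((e.1 : ℕ) / 8 < N / 8 ∨ e.1 = e.2)}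

/-- The disjoint union of `N / 8` copies of the Latin instance on `{0, …, 7}` with square
`x ^^^ y + 1` and of `N % 8` single edges. -/
def blockInstance (N : ℕ) : StableMarriage (Fin N) (Fin N) :=
  ofLabel (blockEdges N) (fun a b => (a % 8) ^^^ (b % 8))
    (fun a b b' h h' heq => by
      have h1 := Nat.xor_right_injective heq
      have h2 := h.1
      have h3 := h'.1
      ext
      simp only at h1 h2 h3
      omega)
    (fun a a' b h h' heq => by
      have h1 := Nat.xor_left_injective heq
      have h2 := h.1
      have h3 := h'.1
      ext
      simp only at h1 h2 h3
      omega)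

/-- The matching that marries the men of the `i`-th block according to `f i`. -/
def blockMatching (N : ℕ) (f : ℕ → ℕ → ℕ) : Set (Fin N × Fin N) :=
  {e | (e.1 : ℕ) / 8 = e.2 / 8 ∧
    (((e.1 : ℕ) / 8 < N / 8 ∧ f (e.1 / 8) (e.1 % 8) = e.2 % 8) ∨
      (¬ (e.1 : ℕ) / 8 < N / 8 ∧ e.1 = e.2))}

variable {N : ℕ} {f : ℕ → ℕ → ℕ}

theorem blockMatching_mem_stableMatchings (hf : ∀ i < N / 8, IsXorStable (f i)) :
    blockMatching N f ∈ (blockInstance N).stableMatchings := by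
  refine ⟨⟨?_, ?_, ?_⟩, ?_⟩
  · rintro ⟨a, b⟩ ⟨h, h' | h'⟩
    · exact ⟨h, .inl h'.1⟩
    · exact ⟨h, .inr h'.2⟩
  · rintro a b b' ⟨h1, h2⟩ ⟨h3, h4⟩
    simp only [Fin.ext_iff] at *
    omega
  · rintro a a' b ⟨h1, h2⟩ ⟨h3, h4⟩
    simp only [Fin.ext_iff] at *
    rcases h2 with ⟨h2, h2'⟩ | h2
    · rcases h4 with ⟨h4, h4'⟩ | h4
      · rw [← h4', h1, ← h3] at h2'
        have := (hf _ h4).inj _ (Nat.mod_lt _ (by norm_num)) _ (Nat.mod_lt _ (by norm_num)) h2'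
        omega
      · omega
    · omega
  · rintro ⟨a, b⟩ - ⟨he, h1, h2⟩
    have hab := he.1
    simp only at hab
    rcases lt_or_ge ((a : ℕ) / 8) (N / 8) with ha | ha
    · have hst := hf _ ha
      have ha8 : (a : ℕ) % 8 < 8 := Nat.mod_lt _ (by norm_num)
      have hw := hst.lt _ ha8
      -- `x` is the position in the block of the husband of `b`; the wife of `a` and this husband,
      -- shifted by `8 * (a / 8)`, are the partners to compare with.
      obtain ⟨x, hx, hxb⟩ := hst.exists_eq (Nat.mod_lt (b : ℕ) (by norm_num : 8 > 0))
      have h3 := (h1 ⟨8 * (a / 8) + f (a / 8) (a % 8), by omega⟩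
        ⟨by simp only; omega, .inl ⟨ha, by simp only; omega⟩⟩).2.2
      have hxm : (8 * ((a : ℕ) / 8) + x) / 8 = a / 8 := by omega
      have hxm' : (8 * ((a : ℕ) / 8) + x) % 8 = x := by omega
      have h4 := (h2 ⟨8 * (a / 8) + x, by omega⟩
        ⟨by simp only; omega, .inl ⟨by simp only [hxm]; exact ha,
          by simp only [hxm, hxm']; exact hxb⟩⟩).2.2
      have h5 := hst.stable _ ha8 x hx
      have h6 : (8 * ((a : ℕ) / 8) + f (a / 8) (a % 8)) % 8 = f (a / 8) (a % 8) := by omega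
      simp only [h6] at h3
      simp only [hxm'] at h4
      rw [hxb] at h5
      exact h5 ⟨h3, h4⟩
    -- Outside the full blocks the only edge at `a` is already in the matching.
    · have heq := he.2.resolve_left (not_lt.2 ha)
      exact lt_irrefl _ (h1 b ⟨hab, .inr ⟨not_lt.2 ha, heq⟩⟩).2.2

theorem isSaturated_blockInstance (N : ℕ) : (blockInstance N).IsSaturated {e | e.1 = e.2} := by
  refine ⟨?_, ⟨?_, ?_, ?_⟩, fun b => ⟨b, rfl⟩, fun a => ⟨a, rfl⟩, ?_⟩
  · rintro ⟨a, b⟩ ⟨h1, h2⟩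
    -- Use in every block the class of the label of the given edge.
    refine ⟨_, blockMatching_mem_stableMatchings (f := fun _ => (· ^^^ (a % 8 ^^^ b % 8)))
      fun i _ => isXorStable_xor (Nat.xor_lt_two_pow (n := 3) (Nat.mod_lt _ (by norm_num))
        (Nat.mod_lt _ (by norm_num))), h1, ?_⟩
    rcases lt_or_ge ((a : ℕ) / 8) (N / 8) with ha | ha
    · refine .inl ⟨ha, ?_⟩
      simp only [← Nat.xor_assoc, Nat.xor_self, Nat.zero_xor]
    · exact .inr ⟨not_lt.2 ha, h2.resolve_left (not_lt.2 ha)⟩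
  · rintro ⟨a, b⟩ h
    obtain rfl : a = b := h
    exact ⟨rfl, .inr rfl⟩
  · rintro a b b' h h'
    exact h.symm.trans h'
  · rintro a a' b h h'
    exact h.trans h'.symm
  · rintro a b b' h hlt
    obtain rfl : a = b := h
    have := hlt.2.2
    simp at this

theorem pow_le_ncard_stableMatchings_blockInstance (N : ℕ) :
    268 ^ (N / 8) ≤ (blockInstance N).stableMatchings.ncard := by
  set T : Finset (List ℕ) := (xorPartialStable 8).toFinset with hT
  have hcard : Nat.card (Fin (N / 8) → {l // l ∈ T}) = 268 ^ (N / 8) := by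
    rw [Nat.card_fun, Nat.card_eq_fintype_card, Fintype.card_coe, hT,
      List.toFinset_card_of_nodup (nodup_xorPartialStable 8), length_xorPartialStable,
      Nat.card_eq_fintype_card, Fintype.card_fin]
  have hmem (t : {l // l ∈ T}) : t.1 ∈ xorPartialStable 8 := List.mem_toFinset.1 t.2
  let w : (Fin (N / 8) → {l // l ∈ T}) → ℕ → ℕ → ℕ := fun g i =>
    if h : i < N / 8 then wife (g ⟨i, h⟩).1 else id
  have hw (g) (i) (hi : i < N / 8) : w g i = wife (g ⟨i, hi⟩).1 := dif_pos hi
  let F : (Fin (N / 8) → {l // l ∈ T}) → (blockInstance N).stableMatchings := fun g =>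
    ⟨blockMatching N (w g), blockMatching_mem_stableMatchings fun i hi => by
      rw [hw g i hi]
      exact isXorStable_wife (hmem _)⟩
  have hF : Function.Injective F := by
    intro g g' h
    have h0 : blockMatching N (w g) = blockMatching N (w g') := congrArg Subtype.val h
    funext i
    have hl := xorPartialStable_spec (hmem (g i))
    have hl' := xorPartialStable_spec (hmem (g' i))
    have hi := i.2
    have key : ∀ x < 8, wife (g i).1 x = wife (g' i).1 x := by
      intro x hx
      have hy := hl.2.1 x hx
      have e1 : (8 * (i : ℕ) + x) / 8 = i := by omega
      have e2 : (8 * (i : ℕ) + x) % 8 = x := by omega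
      have e3 : (8 * (i : ℕ) + wife (g i).1 x) / 8 = i := by omega
      have e4 : (8 * (i : ℕ) + wife (g i).1 x) % 8 = wife (g i).1 x := by omega
      have hm (k) : ((⟨8 * i + x, by omega⟩, ⟨8 * i + wife (g i).1 x, by omega⟩) :
          Fin N × Fin N) ∈ blockMatching N (w k) ↔ wife (k i).1 x = wife (g i).1 x := by
        simp only [blockMatching, Set.mem_ofPred_eq, e1, e2, e3, e4, hi, hw k i hi]
        simp
      exact ((hm g').1 (h0 ▸ (hm g).2 rfl)).symm
    apply Subtype.ext
    refine List.ext_getElem (hl.1.trans hl'.1.symm) fun m h1 h2 => ?_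
    -- Lists start with the last man, so entry `m` belongs to man `7 - m`.
    have := key (7 - m) (by omega)
    have e5 : 8 - 1 - (7 - m) = m := by omega
    simp only [wife, hl.1, hl'.1, e5] at this
    rwa [List.getD_eq_getElem _ _ h1, List.getD_eq_getElem _ _ h2] at this
  rw [← hcard]
  exact Nat.card_le_card_of_injective F hF

end Label

/-! ### The exponential family and its growth -/

/-- The extension of `blockInstance (n - 1)` by one pair, with agents named `0, …, n - 1`. -/
def extendedBlockInstance : ∀ n : ℕ, StableMarriage (Fin n) (Fin n)
  | 0 => blockInstance 0
  | N + 1 => (blockInstance N).extend.relabel (finSuccEquiv N) (finSuccEquiv N)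

theorem extendedBlockInstance_hasLegalProperty_iff (N : ℕ)
    (L : Set (Set (Fin (N + 1) × Fin (N + 1)))) :
    (extendedBlockInstance (N + 1)).HasLegalProperty L ↔
      L = (Prod.map (finSuccEquiv N) (finSuccEquiv N) ⁻¹' ·) ''
        (addNewPair '' (blockInstance N).stableMatchings) :=
  hasLegalProperty_relabel_iff_eq _ _ (isSaturated_blockInstance N).hasLegalProperty_extend_iff L

theorem ncard_stableMatchings_extendedBlockInstance (N : ℕ) :
    (extendedBlockInstance (N + 1)).stableMatchings.ncard = 1 := by
  rw [extendedBlockInstance, stableMatchings_relabel,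
    (isSaturated_blockInstance N).stableMatchings_extend, Set.image_singleton,
    Set.ncard_singleton]

theorem pow_le_ncard_legalMatchings_extendedBlockInstance (N : ℕ) :
    268 ^ (N / 8) ≤ (extendedBlockInstance (N + 1)).legalMatchings.ncard := by
  rw [legalMatchings_eq (extendedBlockInstance_hasLegalProperty_iff N),
    Set.ncard_image_of_injective _ (preimage_prodMap_bijective _ _).1,
    Set.ncard_image_of_injective _ addNewPair_injective]
  exact pow_le_ncard_stableMatchings_blockInstance N

open Filter Asymptotics in
theorem two_pow_isLittleO_ncard_legalMatchings :
    (fun n : ℕ => (2 : ℝ) ^ n) =o[atTop]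
      (fun n : ℕ => ((extendedBlockInstance n).legalMatchings.ncard : ℝ)) := by
  -- Rounding costs at most the factor `256 = 2 ^ 8`, because `n ≤ 8 * ((n - 1) / 8 + 1)`.
  have h1 : (fun n : ℕ => (2 : ℝ) ^ n) =O[atTop] fun n : ℕ => (256 : ℝ) ^ ((n - 1) / 8) := by
    refine IsBigO.of_bound 256 (Eventually.of_forall fun n => ?_)
    rw [Real.norm_of_nonneg (by positivity), Real.norm_of_nonneg (by positivity), ← pow_succ',
      show (256 : ℝ) = 2 ^ 8 by norm_num, ← pow_mul]
    exact pow_le_pow_right₀ (by norm_num) (by omega)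
  have h2 : (fun n : ℕ => (256 : ℝ) ^ ((n - 1) / 8)) =o[atTop]
      fun n : ℕ => (268 : ℝ) ^ ((n - 1) / 8) :=
    (isLittleO_pow_pow_of_lt_left (by norm_num) (by norm_num : (256 : ℝ) < 268)).comp_tendsto
      ((Nat.tendsto_div_const_atTop (by norm_num)).comp (tendsto_sub_atTop_nat 1))
  have h3 : (fun n : ℕ => (268 : ℝ) ^ ((n - 1) / 8)) =O[atTop]
      fun n : ℕ => ((extendedBlockInstance n).legalMatchings.ncard : ℝ) := by
    refine IsBigO.of_bound 1 ((eventually_ge_atTop 1).mono fun n hn => ?_)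
    obtain ⟨N, rfl⟩ := Nat.exists_eq_add_of_le' hn
    rw [Real.norm_of_nonneg (by positivity), Real.norm_of_nonneg (by positivity), one_mul,
      Nat.add_sub_cancel]
    exact_mod_cast pow_le_ncard_legalMatchings_extendedBlockInstance N
  exact h1.trans_isLittleO (h2.trans_isBigO h3)

end StableMarriage

theorem theorem8p1 :
    (∀ (A : Type*) (B : Type*) [Finite A] [Finite B] (n : ℕ) (P : StableMarriage A B),
      P.IsLatin n →
        (∃! L, P.HasLegalProperty L) ∧
        P.legalEdges = P.edges ∧
        P.legalMatchings = P.stableMatchings ∧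
        ∃ P' : StableMarriage (Option A) (Option B),
          P.IsOnePairExtension P' ∧
          P'.stableMatchings.ncard = 1 ∧
          (∃! L, P'.HasLegalProperty L) ∧
          P'.legalMatchings = {M' | ∃ M ∈ P.stableMatchings, M' = StableMarriage.addNewPair M}) ∧
    (∃ R : ∀ n : ℕ, StableMarriage (Fin n) (Fin n),
      (∀ n, Odd n → (R n).stableMatchings.ncard = 1 ∧ ∃! L, (R n).HasLegalProperty L) ∧
      (fun n : ℕ => (2 : ℝ) ^ n) =o[Filter.atTop ⊓ Filter.principal {n : ℕ | Odd n}]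
        (fun n : ℕ => ((R n).legalMatchings.ncard : ℝ))) := by
  -- The growth bound holds along all `n`, hence along the odd ones; oddness is used only for `n >
  -- 0`.
  refine ⟨fun A B _ _ n P hP => ?_, StableMarriage.extendedBlockInstance, fun n hn => ?_,
    StableMarriage.two_pow_isLittleO_ncard_legalMatchings.mono inf_le_left⟩
  · obtain ⟨M₀, h⟩ := hP.exists_isSaturated
    have hL := StableMarriage.hasLegalProperty_iff_eq_stableMatchings h.edge_mem
    have hS := StableMarriage.legalMatchings_eq hL
    refine ⟨StableMarriage.existsUnique_of_hasLegalProperty_iff hL, ?_, hS, P.extend,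
      StableMarriage.isOnePairExtension_extend P, ?_,
      StableMarriage.existsUnique_of_hasLegalProperty_iff h.hasLegalProperty_extend_iff, ?_⟩
    · ext e
      simp only [StableMarriage.legalEdges, hS]
      exact ⟨fun ⟨M, hM, he⟩ => hM.1.1 he, fun he => h.edge_mem e he⟩
    · rw [h.stableMatchings_extend, Set.ncard_singleton]
    · rw [StableMarriage.legalMatchings_eq h.hasLegalProperty_extend_iff]
      ext M
      simp only [Set.mem_image, Set.mem_ofPred_eq, eq_comm]
  · obtain ⟨N, rfl⟩ := Nat.exists_eq_add_of_le' hn.pos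
    exact ⟨StableMarriage.ncard_stableMatchings_extendedBlockInstance N,
      StableMarriage.existsUnique_of_hasLegalProperty_iff
        (StableMarriage.extendedBlockInstance_hasLegalProperty_iff N)⟩
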